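/- Let $n,r,d,m,k$ be nonnegative integers, let $\mathbf q\in\mathbb R^r$, $\mathbf T\in\mathbb R^{m\times n}$, $\mathbf W\in\mathbb R^{m\times r}$, $\mathbf h^0\in\mathbb R^m$, $\mathbf H\in\mathbb R^{m\times d}$, $\mathbf G\in\mathbb R^{k\times d}$, $\mathbf g^0\in\mathbb R^k$, and put $\mathbf h(\zeta)=\mathbf h^0+\mathbf H\zeta$ and $\Xi=\{\zeta\in\mathbb R^d:\mathbf G\zeta\ge\mathbf g^0\}$. Fix $p\in[1,\infty]$ and let $B(\hat\zeta,\epsilon)=\{\zeta\in\mathbb R^d:\|\zeta-\hat\zeta\|_p\le\epsilon\}$. For $\mathbf x\in\mathbb R^n$ and $\zeta\in\mathbb R^d$ let $$Q(\mathbf x,\zeta)=\inf\{\mathbf q^\top\mathbf y:\ \mathbf y\in\mathbb R^r,\ \mathbf T\mathbf x+\mathbf W\mathbf y\ge\mathbf h(\zeta)\},$$ and for $\epsilon>0$, $\mathcal C\subseteq\mathbb R^{r\times d}$ and $\hat\zeta\in\Xi$ let $$Q^{\mathcal C}_\epsilon(\mathbf x,\hat\zeta)=\inf\Big\{\max_{\zeta\in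 B(\hat\zeta,\epsilon)\cap\Xi}\mathbf q^\top(\mathbf y^0+\mathbf Y\zeta):\ \mathbf y^0\in\mathbb R^r,\ \mathbf Y\in\mathcal C,\ \mathbf T\mathbf x+\mathbf W(\mathbf y^0+\mathbf Y\zeta)\ge\mathbf h(\zeta)\ \ \forall\zeta\in B(\hat\zeta,\epsilon)\cap\Xi\Big\},$$ with values in $[-\infty,\infty]$ and $\inf\emptyset=+\infty$. A face of $\Xi$ is a set $\{\zeta\in\Xi:\mathbf c^\top\zeta=\delta\}$ such that $\mathbf c^\top\zeta\le\delta$ holds on $\Xi$; a minimal face of $\Xi$ is an inclusionwise minimal nonempty face. Then the following three conditions are equivalent. **[A4]** There exist $\mathbf x\in\mathbb R^n$ and $\epsilon>0$ such that for every $\hat\zeta\in\Xi$ there is a linear decision rule $\mathbf y(\zeta)=\mathbf y^0+\mathbf Y\zeta$, with $\mathbf y^0\in\mathbb R^r$ and $\mathbf Y\in\mathbb R^{r\times d}$, such that $\mathbf T\mathbf x+\mathbf W\mathbf y(\zeta)\ge\mathbf h(\zeta)$ for all $\zeta\in B(\hat\zeta,\epsilon)\cap\Xi$. **[A5]** There exist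 $\mathbf x\in\mathbb R^n$ and $\epsilon>0$ such that (a) $Q(\mathbf x,\zeta)<\infty$ for all $\zeta\in\Xi$, and (b) for each minimal face $F$ of $\Xi$ there is a matrix $\mathbf Y^F\in\mathbb R^{r\times d}$ with $Q^{\{\mathbf Y^F\}}_\epsilon(\mathbf x,\zeta)<\infty$ for all $\zeta\in F$. **[A6]** There exist $\mathbf x\in\mathbb R^n$, $\epsilon>0$ and a finite set $\mathcal C\subseteq\mathbb R^{r\times d}$ such that $Q^{\mathcal C}_\epsilon(\mathbf x,\zeta)<\infty$ for all $\zeta\in\Xi$. -/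

import Mathlib

open Matrix
open scoped ENNReal

/-- Data of a two-stage linear problem with uncertain right-hand side: `n` first-stage variables,
`r` recourse variables, `d` uncertain parameters, `m` second-stage constraints, and `k` linear
inequalities that describe the support polyhedron. -/
structure TwoStageData (n r d m k : ℕ) where
  /-- second-stage cost vector -/
  q : Fin r → ℝ
  /-- technology matrix -/
  T : Matrix (Fin m) (Fin n) ℝ
  /-- second-stage constraint matrix -/
  W : Matrix (Fin m) (Fin r) ℝ
  /-- constant part of the right-hand side -/
  h₀ : Fin m → ℝ
  /-- linear part of the right-hand side -/
  H : Matrix (Fin m) (Fin d) ℝ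
  /-- left-hand side of the inequalities of the support polyhedron -/
  G : Matrix (Fin k) (Fin d) ℝ
  /-- right-hand side of the inequalities of the support polyhedron -/
  g₀ : Fin k → ℝ

/-- The linear decision rules `ζ ↦ y₀ + Y ζ`. -/
def linearRules (d r : ℕ) : Set ((Fin d → ℝ) → (Fin r → ℝ)) :=
  {y | ∃ (y₀ : Fin r → ℝ) (Y : Matrix (Fin r) (Fin d) ℝ), ∀ ζ, y ζ = y₀ + Y *ᵥ ζ}

/-- The closed `ℓ_p` ball with centre `c` and radius `ε`. -/
def lpBall {d : ℕ} (p : ℝ≥0∞) (c : Fin d → ℝ) (ε : ℝ) : Set (Fin d → ℝ) :=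
  {ζ | ‖WithLp.toLp p (ζ - c)‖ ≤ ε}

/-- `F` is a minimal face of `P`: it is inclusionwise minimal among the nonempty faces of `P`.
A nonempty set is a face when it is the set of maximizers over `P` of some linear functional
(equivalently, `P ∩ {ζ | c ⬝ᵥ ζ = δ}` for a valid inequality `c ⬝ᵥ ζ ≤ δ`); the zero functional
gives `P` itself. -/
def IsMinimalFace {d : ℕ} (P F : Set (Fin d → ℝ)) : Prop :=
  Minimal (fun S : Set (Fin d → ℝ) => S.Nonempty ∧ IsExposed ℝ P S) F

namespace TwoStageData

variable {n r d m k : ℕ} (D : TwoStageData n r d m k)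

/-- The affine right-hand side `h(ζ) = h₀ + H ζ`. -/
def h (ζ : Fin d → ℝ) : Fin m → ℝ := D.h₀ + D.H *ᵥ ζ

/-- The support polyhedron `Ξ = {ζ | G ζ ≥ g₀}`. -/
def support : Set (Fin d → ℝ) := {ζ | D.g₀ ≤ D.G *ᵥ ζ}

/-- The recourse decision `y` satisfies `T x + W y ≥ h(ζ)`. -/
def Feasible (x : Fin n → ℝ) (ζ : Fin d → ℝ) (y : Fin r → ℝ) : Prop :=
  D.h ζ ≤ D.T *ᵥ x + D.W *ᵥ y

/-- The second-stage cost `Q(x, ζ)`, an extended real; it is `⊤` if no recourse is feasible. -/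
noncomputable def Q (x : Fin n → ℝ) (ζ : Fin d → ℝ) : EReal :=
  ⨅ (y : Fin r → ℝ) (_ : D.Feasible x ζ y), ((D.q ⬝ᵥ y : ℝ) : EReal)

/-- The cost `Q^𝓒_ε(x, ζ')` of the best linear decision rule with recourse matrix in `𝓒` that is
feasible on `B(ζ', ε) ∩ Ξ`, the cost of a rule being its worst case on this set; it is `⊤` if there
is no such rule. -/
noncomputable def QC (p : ℝ≥0∞) (𝓒 : Set (Matrix (Fin r) (Fin d) ℝ)) (ε : ℝ)
    (x : Fin n → ℝ) (ζ' : Fin d → ℝ) : EReal :=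
  ⨅ (y₀ : Fin r → ℝ) (Y : Matrix (Fin r) (Fin d) ℝ) (_ : Y ∈ 𝓒)
    (_ : ∀ ζ ∈ lpBall p ζ' ε ∩ D.support, D.Feasible x ζ (y₀ + Y *ᵥ ζ)),
    ⨆ ζ ∈ lpBall p ζ' ε ∩ D.support, ((D.q ⬝ᵥ (y₀ + Y *ᵥ ζ) : ℝ) : EReal)

/-- Some first-stage decision and radius admit, around every point of `Ξ`,
a locally feasible linear decision rule. -/
def LocallyLinearFeasible (p : ℝ≥0∞) : Prop :=
  ∃ (x : Fin n → ℝ) (ε : ℝ), 0 < ε ∧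
    ∀ ζ' ∈ D.support, ∃ y ∈ linearRules d r,
      ∀ ζ ∈ lpBall p ζ' ε ∩ D.support, D.Feasible x ζ (y ζ)

/-- For some first-stage decision and radius: finite second-stage cost on `Ξ`, and one recourse matrix for each minimal
face of `Ξ`. -/
def MinimalFaceFeasible (p : ℝ≥0∞) : Prop :=
  ∃ (x : Fin n → ℝ) (ε : ℝ), 0 < ε ∧
    (∀ ζ ∈ D.support, D.Q x ζ < ⊤) ∧
    ∀ F : Set (Fin d → ℝ), IsMinimalFace D.support F →
      ∃ Y : Matrix (Fin r) (Fin d) ℝ, ∀ ζ ∈ F, D.QC p {Y} ε x ζ < ⊤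

/-- For some first-stage decision and radius, finitely many recourse matrices suffice on all of `Ξ`. -/
def FinitelyManyFeasible (p : ℝ≥0∞) : Prop :=
  ∃ (x : Fin n → ℝ) (ε : ℝ), 0 < ε ∧
    ∃ 𝓒 : Set (Matrix (Fin r) (Fin d) ℝ), 𝓒.Finite ∧
      ∀ ζ ∈ D.support, D.QC p 𝓒 ε x ζ < ⊤

end TwoStageData

/-!
All three conditions concern the existence of *local rules*: linear rules feasible on a
neighbourhood, in `Ξ`, of a given point. Costs of rules are finite on bounded sets
(`QC_lt_top_iff`), and the `ℓ_p` balls may be replaced by sup-norm balls.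

Two facts do the work.

* *Uniformity.* If every point of `Ξ` has some local rule, then one radius and finitely many
  matrices suffice (`exists_finite_of_pointwise`). On a compact set this is a covering argument,
  as a rule near a point is a rule near all neighbouring points. The general case reduces to a
  compact set: every point `ζ` of `Ξ` is `η + v` with `η` in a fixed compact subset, `v` a recession
  direction, and `Ξ` near `ζ` contained in the translate by `v` of `Ξ` near `η`
  (`exists_compact_representatives`). Feasibility on all of `Ξ` supplies a recourse direction for
  `v` (`exists_recession_recourse`), so the rule at `η` can be transported to `ζ`. Both steps rest
  on truncating slack vectors (`exists_bounded_truncation`), which here takes the place of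
  Minkowski--Weyl and Farkas.

* *Spreading.* If `Y` gives a local rule at `a`, it gives one at each `ζ` all of whose tight
  inequalities are tight at `a` (`HasLocalRule.of_active_subset`). At `ζ` take a recourse decision
  with as few tight constraints as possible. A constraint tight there is tight for every decision,
  hence, by convexity, along the rule from `a` towards `ζ`; so the slack of that constraint changes
  along the rule at a nonnegative rate in every direction from `ζ` into `Ξ`. Every `ζ` admits such
  an `a` in a minimal face (`exists_isMinimalFace`).

Conversely a local rule at one point of a minimal face serves the whole face, because a minimal
face lies in a single translate of the lineality space of `Ξ` (`mulVec_eq_of_isMinimalFace`).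
-/

open Filter Topology

/-! ### Truncation of slack vectors -/

/-- In a polyhedron of slack vectors, every `s` can be lowered within the polyhedron to a vector `t`
of uniformly bounded norm, changing only coordinates that stay at least `1`. Otherwise the minimal
truncations are unbounded, and a limit of their directions is a nonnegative direction along which
one of them could be lowered further. -/
theorem exists_bounded_truncation {ι : Type*} [Fintype ι] (V : Submodule ℝ (ι → ℝ)) (p : ι → ℝ) :
    ∃ R : ℝ, ∀ s : ι → ℝ, 0 ≤ s → s - p ∈ V →
      ∃ t : ι → ℝ, s - t ∈ V ∧ (∀ j, min (s j) 1 ≤ t j) ∧ t ≤ s ∧ ‖t‖ ≤ R := by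
  have hV : IsClosed (V : Set (ι → ℝ)) := V.closed_of_finiteDimensional
  -- Each `s` has an admissible truncation with least coordinate sum.
  have hmin : ∀ s : ι → ℝ, ∃ t : ι → ℝ, s - t ∈ V ∧ (∀ j, min (s j) 1 ≤ t j) ∧ t ≤ s ∧
      ∀ t' : ι → ℝ, s - t' ∈ V → (∀ j, min (s j) 1 ≤ t' j) → t' ≤ s → ∑ j, t j ≤ ∑ j, t' j := by
    intro s
    have hc : IsCompact (Set.Icc (fun j => min (s j) 1) s ∩ {t | s - t ∈ V}) :=
      isCompact_Icc.inter_right (hV.preimage (continuous_const.sub continuous_id))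
    obtain ⟨t, ⟨⟨ht1, ht2⟩, ht3⟩, ht⟩ := hc.exists_isMinOn
      ⟨s, ⟨⟨fun j => min_le_left _ _, le_rfl⟩, by simp⟩⟩
      (f := fun t : ι → ℝ => ∑ j, t j) (by fun_prop)
    exact ⟨t, ht3, ht1, ht2, fun t' h1 h2 h3 => ht ⟨⟨h2, h3⟩, h1⟩⟩
  by_contra! hcon
  have hseq : ∀ N : ℕ, ∃ s t : ι → ℝ, 0 ≤ s ∧ s - p ∈ V ∧ s - t ∈ V ∧ (∀ j, min (s j) 1 ≤ t j) ∧
      t ≤ s ∧ (∀ t' : ι → ℝ, s - t' ∈ V → (∀ j, min (s j) 1 ≤ t' j) → t' ≤ s →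
        ∑ j, t j ≤ ∑ j, t' j) ∧ (N : ℝ) < ‖t‖ := by
    intro N
    obtain ⟨s, hs, hsp, h⟩ := hcon N
    obtain ⟨t, h1, h2, h3, h4⟩ := hmin s
    exact ⟨s, t, hs, hsp, h1, h2, h3, h4, h t h1 h2 h3⟩
  choose s t hs hsp h1 h2 h3 h4 h5 using hseq
  have hpos : ∀ N, 0 < ‖t N‖ := fun N => lt_of_le_of_lt (Nat.cast_nonneg N) (h5 N)
  have ht0 : ∀ N j, 0 ≤ t N j := fun N j => le_trans (le_min (hs N j) zero_le_one) (h2 N j)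
  obtain ⟨τ, hτ, φ, hφ, hlim⟩ := (isCompact_sphere (0 : ι → ℝ) 1).tendsto_subseq
    (x := fun N => ‖t N‖⁻¹ • t N) (fun N => by
      simp [norm_smul, (hpos N).ne'])
  have hnorm : Tendsto (fun N => ‖t (φ N)‖) atTop atTop :=
    (tendsto_atTop_mono (fun N => (h5 N).le) tendsto_natCast_atTop_atTop).comp hφ.tendsto_atTop
  have hinv : Tendsto (fun N => ‖t (φ N)‖⁻¹) atTop (𝓝 0) := tendsto_inv_atTop_zero.comp hnorm
  have hτV : τ ∈ V := by
    have hl : Tendsto (fun N => ‖t (φ N)‖⁻¹ • t (φ N) - ‖t (φ N)‖⁻¹ • p) atTop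
        (𝓝 (τ - (0 : ℝ) • p)) :=
      hlim.sub (hinv.smul_const p)
    rw [zero_smul, sub_zero] at hl
    refine hV.mem_of_tendsto hl (Eventually.of_forall fun N => ?_)
    rw [← smul_sub]
    have : t (φ N) - p = (s (φ N) - p) - (s (φ N) - t (φ N)) := by abel
    rw [SetLike.mem_coe, this]
    exact V.smul_mem _ (V.sub_mem (hsp _) (h1 _))
  have hτj : ∀ j, Tendsto (fun N => ‖t (φ N)‖⁻¹ * t (φ N) j) atTop (𝓝 (τ j)) := fun j =>
    (tendsto_pi_nhds.1 hlim j)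
  have hτ0 : ∀ j, 0 ≤ τ j := fun j =>
    ge_of_tendsto' (hτj j) fun N => mul_nonneg (inv_nonneg.2 (norm_nonneg _)) (ht0 _ _)
  -- Coordinates in which `τ` is positive blow up along the sequence, so `τ` may be subtracted.
  have hev : ∀ᶠ N in atTop, ∀ j, 0 < τ j → 1 ≤ t (φ N) j - τ j := by
    refine eventually_all.2 fun j => ?_
    by_cases hj : 0 < τ j
    · have : Tendsto (fun N => t (φ N) j) atTop atTop := by
        refine ((hτj j).pos_mul_atTop hj hnorm).congr fun N => ?_
        have := (hpos (φ N)).ne'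
        field_simp
      filter_upwards [this.eventually_ge_atTop (1 + τ j)] with N hN _
      linarith
    · exact Eventually.of_forall fun N h => absurd h hj
  obtain ⟨N, hN⟩ := hev.exists
  have hle := h4 (φ N) (t (φ N) - τ)
    (by
      have : s (φ N) - (t (φ N) - τ) = (s (φ N) - t (φ N)) + τ := by abel
      rw [this]
      exact V.add_mem (h1 _) hτV)
    (fun j => by
      rcases (hτ0 j).lt_or_eq with hj | hj
      · exact (min_le_right _ _).trans (hN j hj)
      · simpa [← hj] using h2 (φ N) j)
    (fun j => by
      have := h3 (φ N) j
      have := hτ0 j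
      simp only [Pi.sub_apply]
      linarith)
  have hsum : ∑ j, τ j = 0 := by
    refine le_antisymm ?_ (Finset.sum_nonneg fun j _ => hτ0 j)
    simp only [Pi.sub_apply, Finset.sum_sub_distrib] at hle
    linarith
  have hτz : τ = 0 := by
    ext j
    exact (Finset.sum_eq_zero_iff_of_nonneg fun j _ => hτ0 j).1 hsum j (Finset.mem_univ j)
  simp [hτz] at hτ

/-- A system `b + t • c ≤ W y` solvable for all `t ≥ 0` has a recession solution `c ≤ W w`:
truncating the slacks at a solution with large `t` leaves a difference with positive `t`-part. -/
theorem exists_recession_solution {ι E : Type*} [Fintype ι] [AddCommGroup E] [Module ℝ E]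
    (W : E →ₗ[ℝ] (ι → ℝ)) (b c : ι → ℝ) (h : ∀ t : ℝ, 0 ≤ t → ∃ y, b + t • c ≤ W y) :
    ∃ w, c ≤ W w := by
  -- In `(τ, y)`-space, the constraints are `0 ≤ τ` (index `none`) and `b + τ • c ≤ W y`.
  let A : ℝ × E →ₗ[ℝ] (Option ι → ℝ) :=
    { toFun := fun z i => i.elim z.1 fun j => W z.2 j - z.1 * c j
      map_add' := fun z z' => by
        ext i
        cases i <;> simp
        ring
      map_smul' := fun a z => by
        ext i
        cases i <;> simp
        ring }
  obtain ⟨R, hR⟩ := exists_bounded_truncation (LinearMap.range A) (fun i => i.elim 0 fun j => - b j)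
  obtain ⟨y, hy⟩ := h (|R| + 1) (by positivity)
  obtain ⟨t, ⟨⟨τ, w⟩, hz⟩, -, hts, htR⟩ := hR
    (fun i => i.elim (|R| + 1) fun j => W y j - (|R| + 1) * c j - b j)
    (fun i => by
      cases i with
      | none => simp; positivity
      | some j =>
        have := hy j
        simp at this ⊢
        linarith)
    ⟨(|R| + 1, y), by
      ext i
      cases i <;> simp [A]⟩
  have h0 := congrFun hz none
  have hn := (le_abs_self _).trans ((norm_le_pi_norm t none).trans htR)
  simp [A] at h0
  have hτ : 0 < τ := by
    have := le_abs_self R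
    linarith
  refine ⟨τ⁻¹ • w, fun j => ?_⟩
  have hj := congrFun hz (some j)
  have hs := hts (some j)
  simp [A] at hj hs
  have : τ * c j ≤ W w j := by linarith
  rw [map_smul, Pi.smul_apply, smul_eq_mul, inv_mul_eq_div, le_div_iff₀ hτ]
  linarith

namespace TwoStageData

variable {n r d m k : ℕ} (D : TwoStageData n r d m k)

/-! ### The support polyhedron and its minimal faces -/

/-- The set of indices of the inequalities of `Ξ` that are tight at `ζ`. -/
def active (ζ : Fin d → ℝ) : Set (Fin k) := {j | D.g₀ j = (D.G *ᵥ ζ) j}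

theorem exists_pos_add_smul_mem_support {ζ v : Fin d → ℝ} (hζ : ζ ∈ D.support)
    (hv : ∀ j ∈ D.active ζ, 0 ≤ (D.G *ᵥ v) j) : ∃ κ : ℝ, 0 < κ ∧ ζ + κ • v ∈ D.support := by
  have : ∀ᶠ κ : ℝ in 𝓝[>] 0, ∀ j, D.g₀ j ≤ (D.G *ᵥ ζ) j + κ * (D.G *ᵥ v) j := by
    refine eventually_all.2 fun j => ?_
    rcases (hζ j).lt_or_eq with h | h
    · have hc : Continuous fun κ : ℝ => (D.G *ᵥ ζ) j + κ * (D.G *ᵥ v) j := by fun_prop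
      have := hc.tendsto 0
      simp only [zero_mul, add_zero] at this
      filter_upwards [nhdsWithin_le_nhds (this.eventually (lt_mem_nhds h))] with κ hκ using hκ.le
    · filter_upwards [self_mem_nhdsWithin] with κ hκ
      have := mul_nonneg (le_of_lt (Set.mem_Ioi.1 hκ)) (hv j h)
      linarith
  obtain ⟨κ, h1, h2⟩ := (this.and self_mem_nhdsWithin).exists
  refine ⟨κ, h2, fun j => ?_⟩
  simpa [mulVec_add, mulVec_smul] using h1 j

theorem convex_support : Convex ℝ D.support := by
  intro a ha b hb s t hs ht hst j
  have h1 := mul_le_mul_of_nonneg_left (ha j) hs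
  have h2 := mul_le_mul_of_nonneg_left (hb j) ht
  have h3 : D.g₀ j = s * D.g₀ j + t * D.g₀ j := by rw [← add_mul, hst, one_mul]
  simp only [mulVec_add, mulVec_smul, Pi.add_apply, Pi.smul_apply, smul_eq_mul]
  linarith

theorem isClosed_support : IsClosed D.support :=
  isClosed_le continuous_const (by fun_prop)

/-- The face of `Ξ` cut out by the inequalities that are tight at `ζ`: the smallest face
containing `ζ`. -/
def tightFace (ζ : Fin d → ℝ) : Set (Fin d → ℝ) := {η ∈ D.support | D.active ζ ⊆ D.active η}

theorem isExposed_tightFace {ζ : Fin d → ℝ} (hζ : ζ ∈ D.support) :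
    IsExposed ℝ D.support (D.tightFace ζ) := by
  classical
  intro _
  let J := Finset.univ.filter fun j => j ∈ D.active ζ
  let l : (Fin d → ℝ) →ₗ[ℝ] ℝ := -∑ j ∈ J, LinearMap.proj j ∘ₗ D.G.mulVecLin
  have hl : ∀ η, l η = -∑ j ∈ J, (D.G *ᵥ η) j := fun η => by simp [l]
  have hval : l ζ = -∑ j ∈ J, D.g₀ j := by
    rw [hl]
    congr 1
    exact Finset.sum_congr rfl fun j hj => ((Finset.mem_filter.1 hj).2 : D.g₀ j = _).symm
  have hle : ∀ η ∈ D.support, l η ≤ l ζ := fun η hη => by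
    rw [hl, hval]
    exact neg_le_neg (Finset.sum_le_sum fun j _ => hη j)
  refine ⟨l.toContinuousLinearMap, Set.ext fun η => and_congr_right fun hη => ?_⟩
  constructor
  · intro h y hy
    refine (hle y hy).trans (le_of_eq ?_)
    rw [hval]
    change _ = l η
    rw [hl]
    congr 1
    exact Finset.sum_congr rfl fun j hj => h (Finset.mem_filter.1 hj).2
  · intro h j hj
    have h1 : l ζ ≤ l η := h ζ hζ
    rw [hval, hl, neg_le_neg_iff] at h1
    exact (Finset.sum_eq_sum_iff_of_le fun j _ => hη j).1
      ((Finset.sum_le_sum fun j _ => hη j).antisymm h1) j (by simp [J, hj])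

/-- If an exposed set contains `a`, it contains every point of `Ξ` with at least the same tight
inequalities: one can step from `a` a little away from such a point without leaving `Ξ`. -/
theorem tightFace_subset_of_isExposed {F : Set (Fin d → ℝ)} (hF : IsExposed ℝ D.support F)
    {a : Fin d → ℝ} (ha : a ∈ F) : D.tightFace a ⊆ F := by
  rintro η ⟨hη, hJ⟩
  obtain ⟨l, rfl⟩ := hF ⟨a, ha⟩
  obtain ⟨κ, hκ, hmem⟩ := D.exists_pos_add_smul_mem_support ha.1 (v := a - η) fun j hj => by
    have h1 : D.g₀ j = _ := hj
    have h2 : D.g₀ j = _ := hJ hj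
    simp [mulVec_sub, ← h1, ← h2]
  have h := ha.2 _ hmem
  simp only [map_add, map_smul, map_sub, smul_eq_mul] at h
  have : l a - l η ≤ 0 := by
    by_contra! hc
    have := mul_pos hκ hc
    linarith
  exact ⟨hη, fun y hy => (ha.2 y hy).trans (by linarith)⟩

theorem exists_maximal_active {S : Set (Fin d → ℝ)} (hS : S.Nonempty) :
    ∃ a ∈ S, ∀ b ∈ S, D.active a ⊆ D.active b → D.active b ⊆ D.active a := by
  obtain ⟨a, ha⟩ := Set.Finite.exists_maximalFor' D.active S (Set.toFinite _) hS
  exact ⟨a, ha.1, fun b hb h => ha.2 hb h⟩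

theorem exists_isMinimalFace {ζ : Fin d → ℝ} (hζ : ζ ∈ D.support) :
    ∃ (F : Set (Fin d → ℝ)) (a : Fin d → ℝ), IsMinimalFace D.support F ∧ a ∈ F ∧ a ∈ D.support ∧
      D.active ζ ⊆ D.active a := by
  obtain ⟨a, ha, hmax⟩ := D.exists_maximal_active (S := D.tightFace ζ) ⟨ζ, hζ, subset_rfl⟩
  refine ⟨D.tightFace a, a, ⟨⟨⟨a, ha.1, subset_rfl⟩, D.isExposed_tightFace ha.1⟩, ?_⟩,
    ⟨ha.1, subset_rfl⟩, ha.1, ha.2⟩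
  rintro F' ⟨⟨b, hb⟩, hF'⟩ hsub η hη
  have hba := hsub hb
  exact D.tightFace_subset_of_isExposed hF' hb
    ⟨hη.1, (hmax b ⟨hba.1, ha.2.trans hba.2⟩ hba.2).trans hη.2⟩

/-- A minimal face lies in one translate of the lineality space `ker G`: all tight sets along it
agree, so a line through two of its points never meets a new inequality. -/
theorem mulVec_eq_of_isMinimalFace {F : Set (Fin d → ℝ)} (hF : IsMinimalFace D.support F)
    {ζ η : Fin d → ℝ} (hζ : ζ ∈ F) (hη : η ∈ F) : D.G *ᵥ ζ = D.G *ᵥ η := by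
  obtain ⟨a, ha, hmax⟩ := D.exists_maximal_active hF.1.1
  have hFs : F ⊆ D.support := hF.1.2.subset
  have hFa : F ⊆ D.tightFace a := hF.2 ⟨⟨a, hFs ha, subset_rfl⟩, D.isExposed_tightFace (hFs ha)⟩
    (D.tightFace_subset_of_isExposed hF.1.2 ha)
  suffices key : ∀ ζ ∈ F, ∀ η ∈ F, ∀ j, ¬ (D.G *ᵥ ζ) j < (D.G *ᵥ η) j from
    funext fun j => le_antisymm (not_lt.1 (key η hη ζ hζ j)) (not_lt.1 (key ζ hζ η hη j))
  clear hζ hη ζ η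
  intro ζ hζ η hη j hj
  classical
  -- If `G η` exceeds `G ζ` in some coordinate, move from `ζ` in the direction `ζ - η` until the
  -- first new inequality becomes tight.
  let s : Fin k → ℝ := fun i => (D.G *ᵥ η) i - (D.G *ᵥ ζ) i
  let κ : Fin k → ℝ := fun i => ((D.G *ᵥ ζ) i - D.g₀ i) / s i
  obtain ⟨i, hi, hmin⟩ := (Finset.univ.filter fun i => 0 < s i).exists_min_image κ
    ⟨j, by simpa [s] using hj⟩
  have hsi : 0 < s i := (Finset.mem_filter.1 hi).2
  have hκ : 0 ≤ κ i := div_nonneg (sub_nonneg.2 (hFs hζ i)) hsi.le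
  let ξ := ζ + κ i • (ζ - η)
  have hξ : ∀ l, (D.G *ᵥ ξ) l = (D.G *ᵥ ζ) l - κ i * s l := fun l => by
    simp only [ξ, s, mulVec_add, mulVec_smul, mulVec_sub, Pi.add_apply, Pi.smul_apply,
      Pi.sub_apply, smul_eq_mul]
    ring
  have hξs : ξ ∈ D.support := fun l => by
    rw [hξ]
    have hl := hFs hζ l
    by_cases h : 0 < s l
    · have := (le_div_iff₀ h).1 (hmin l (by simpa using h))
      linarith
    · have := mul_nonneg hκ (sub_nonneg.2 (not_lt.1 h))
      simp only [zero_sub, mul_neg] at this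
      linarith
  have haξ : D.active a ⊆ D.active ξ := fun l hl => by
    have h1 : D.g₀ l = _ := (hFa hζ).2 hl
    have h2 : D.g₀ l = _ := (hFa hη).2 hl
    change D.g₀ l = _
    rw [hξ]
    simp only [s]
    rw [← h1, ← h2]
    ring
  have hξi : i ∈ D.active ξ := by
    change D.g₀ i = _
    rw [hξ]
    simp only [κ]
    field_simp
    ring
  have hia := hmax ξ (D.tightFace_subset_of_isExposed hF.1.2 ha ⟨hξs, haξ⟩) haξ hξi
  have h1 : D.g₀ i = _ := (hFa hζ).2 hia
  have h2 : D.g₀ i = _ := (hFa hη).2 hia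
  simp only [s] at hsi
  linarith


/-! ### Local rules and slacks -/

/-- The recourse matrix `Y` yields a linear rule that is feasible on the part of `Ξ` at
sup-norm distance at most `ρ` from `ζ'`. The rule is written in coordinates centred at `ζ'`. -/
def HasLocalRule (x : Fin n → ℝ) (Y : Matrix (Fin r) (Fin d) ℝ) (ζ' : Fin d → ℝ) (ρ : ℝ) : Prop :=
  ∃ y₀ : Fin r → ℝ, ∀ u : Fin d → ℝ, ‖u‖ ≤ ρ → ζ' + u ∈ D.support →
    D.Feasible x (ζ' + u) (y₀ + Y *ᵥ u)

/-- The slack of the second-stage constraints; it is affine in `(ζ, y)`. -/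
def slack (x : Fin n → ℝ) (ζ : Fin d → ℝ) (y : Fin r → ℝ) : Fin m → ℝ :=
  D.T *ᵥ x + D.W *ᵥ y - D.h ζ

/-- The rate of change of the slack in the direction `u` along a rule with matrix `Y`. -/
def slackRate (Y : Matrix (Fin r) (Fin d) ℝ) (u : Fin d → ℝ) : Fin m → ℝ :=
  D.W *ᵥ (Y *ᵥ u) - D.H *ᵥ u

variable {D} {x : Fin n → ℝ}

theorem feasible_iff {ζ : Fin d → ℝ} {y : Fin r → ℝ} :
    D.Feasible x ζ y ↔ ∀ j, 0 ≤ D.slack x ζ y j := by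
  simp [Feasible, slack, Pi.le_def]

theorem slack_add (ζ u : Fin d → ℝ) (y : Fin r → ℝ) (Y : Matrix (Fin r) (Fin d) ℝ) (j : Fin m) :
    D.slack x (ζ + u) (y + Y *ᵥ u) j = D.slack x ζ y j + D.slackRate Y u j := by
  simp only [slack, slackRate, h, mulVec_add, Pi.add_apply, Pi.sub_apply]
  ring

theorem slack_convexComb {s t : ℝ} (hst : s + t = 1) (ζ η : Fin d → ℝ) (y z : Fin r → ℝ)
    (j : Fin m) : D.slack x (s • ζ + t • η) (s • y + t • z) j =
      s * D.slack x ζ y j + t * D.slack x η z j := by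
  obtain rfl : s = 1 - t := by linarith
  simp only [slack, h, mulVec_add, mulVec_smul, Pi.add_apply, Pi.sub_apply, Pi.smul_apply,
    smul_eq_mul]
  ring

theorem slackRate_add (Y : Matrix (Fin r) (Fin d) ℝ) (u v : Fin d → ℝ) (j : Fin m) :
    D.slackRate Y (u + v) j = D.slackRate Y u j + D.slackRate Y v j := by
  simp only [slackRate, mulVec_add, Pi.add_apply, Pi.sub_apply]
  ring

theorem slackRate_smul (Y : Matrix (Fin r) (Fin d) ℝ) (t : ℝ) (u : Fin d → ℝ) (j : Fin m) :
    D.slackRate Y (t • u) j = t * D.slackRate Y u j := by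
  simp only [slackRate, mulVec_smul, Pi.sub_apply, Pi.smul_apply, smul_eq_mul]
  ring

theorem HasLocalRule.mono {Y : Matrix (Fin r) (Fin d) ℝ} {ζ' : Fin d → ℝ} {ρ ρ' : ℝ}
    (h : D.HasLocalRule x Y ζ' ρ) (hρ : ρ' ≤ ρ) : D.HasLocalRule x Y ζ' ρ' :=
  h.imp fun _ hy u hu => hy u (hu.trans hρ)

theorem HasLocalRule.of_norm_sub_le {Y : Matrix (Fin r) (Fin d) ℝ} {ζ η : Fin d → ℝ} {ρ ρ' : ℝ}
    (h : D.HasLocalRule x Y ζ ρ) (hρ : ‖η - ζ‖ + ρ' ≤ ρ) : D.HasLocalRule x Y η ρ' := by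
  obtain ⟨y₀, hy⟩ := h
  refine ⟨y₀ + Y *ᵥ (η - ζ), fun u hu hmem => ?_⟩
  have heq : ζ + (η - ζ + u) = η + u := by abel
  have := hy (η - ζ + u) ((norm_add_le _ _).trans (by linarith)) (by rwa [heq])
  rwa [heq, mulVec_add, ← add_assoc] at this

/-- Along a recession direction `v` of `Ξ`, recourse is feasible arbitrarily far out, hence some
recourse direction keeps up with the right-hand side. -/
theorem exists_recession_recourse (hfeas : ∀ ζ ∈ D.support, ∃ y, D.Feasible x ζ y)
    {a v : Fin d → ℝ} (ha : a ∈ D.support) (hv : 0 ≤ D.G *ᵥ v) : ∃ w, D.H *ᵥ v ≤ D.W *ᵥ w := by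
  refine exists_recession_solution D.W.mulVecLin (D.h a - D.T *ᵥ x) _ fun t ht => ?_
  obtain ⟨y, hy⟩ := hfeas (a + t • v) (fun j => by
    have h1 := ha j
    have h2 := mul_nonneg ht (hv j)
    simp only [mulVec_add, mulVec_smul, Pi.add_apply, Pi.smul_apply, smul_eq_mul]
    linarith)
  refine ⟨y, fun j => ?_⟩
  have := hy j
  simp only [h, mulVec_add, mulVec_smul, Pi.add_apply, Pi.sub_apply, Pi.smul_apply,
    mulVecLin_apply] at this ⊢
  linarith

/-- A local rule at `η` can be transported, with the same matrix, along a recession direction of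
`Ξ` in which no constraint near `η` gets lost. -/
theorem HasLocalRule.transport (hfeas : ∀ ζ ∈ D.support, ∃ y, D.Feasible x ζ y)
    {Y : Matrix (Fin r) (Fin d) ℝ} {ζ η : Fin d → ℝ} {ρ : ℝ} (h : D.HasLocalRule x Y η ρ)
    (hη : η ∈ D.support) (hv : 0 ≤ D.G *ᵥ (ζ - η))
    (hmem : ∀ u : Fin d → ℝ, ‖u‖ ≤ ρ → ζ + u ∈ D.support → η + u ∈ D.support) :
    D.HasLocalRule x Y ζ ρ := by
  obtain ⟨w, hw⟩ := exists_recession_recourse hfeas hη hv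
  obtain ⟨y₀, hy⟩ := h
  refine ⟨y₀ + w, fun u hu hu' j => ?_⟩
  have h1 := hy u hu (hmem u hu hu') j
  have h2 := hw j
  simp only [TwoStageData.h, mulVec_add, mulVec_sub, Pi.add_apply, Pi.sub_apply] at h1 h2 ⊢
  linarith

/-! ### Uniformity by compactness -/

variable (D) in
/-- Up to recession directions, every local picture of `Ξ` already occurs in a compact set: slacks
larger than a constant do not influence the local shape and may be truncated. -/
theorem exists_compact_representatives : ∃ (K : Set (Fin d → ℝ)) (δ : ℝ), IsCompact K ∧ 0 < δ ∧
    ∀ ζ ∈ D.support, ∃ η ∈ K, η ∈ D.support ∧ 0 ≤ D.G *ᵥ (ζ - η) ∧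
      ∀ u : Fin d → ℝ, ‖u‖ ≤ δ → ζ + u ∈ D.support → η + u ∈ D.support := by
  obtain ⟨R, hR⟩ := exists_bounded_truncation (LinearMap.range D.G.mulVecLin) (-D.g₀)
  obtain ⟨σ, hσ⟩ := LinearMap.exists_rightInverse_of_surjective D.G.mulVecLin.rangeRestrict
    (LinearMap.range_rangeRestrict _)
  have hσ' : ∀ v, D.G *ᵥ σ v = v := fun v => by
    simpa using congrArg Subtype.val (LinearMap.congr_fun hσ v)
  obtain ⟨δ, hδ, hball⟩ : ∃ δ > 0, ∀ u : Fin d → ℝ, ‖u‖ ≤ δ → ‖D.G *ᵥ u‖ ≤ 1 := by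
    have hc : Continuous fun u : Fin d → ℝ => ‖D.G *ᵥ u‖ := by fun_prop
    have := hc.tendsto 0
    simp only [mulVec_zero, norm_zero] at this
    obtain ⟨δ, hδ, h⟩ := Metric.nhds_basis_closedBall.eventually_iff.1
      (this.eventually (gt_mem_nhds zero_lt_one))
    exact ⟨δ, hδ, fun u hu => (h (by simpa using hu)).le⟩
  refine ⟨Metric.closedBall 0 (‖σ.toContinuousLinearMap‖ * (R + ‖D.g₀‖)), δ,
    isCompact_closedBall _ _, hδ, fun ζ hζ => ?_⟩
  obtain ⟨t, ⟨v, hv⟩, ht1, ht2, htR⟩ := hR (D.G *ᵥ ζ - D.g₀) (sub_nonneg.2 hζ) ⟨ζ, by simp⟩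
  have hmem : t + D.g₀ ∈ LinearMap.range D.G.mulVecLin := by
    refine ⟨ζ - v, ?_⟩
    rw [map_sub, hv, mulVecLin_apply]
    abel
  have hη : D.G *ᵥ σ ⟨t + D.g₀, hmem⟩ = t + D.g₀ := hσ' _
  refine ⟨σ ⟨t + D.g₀, hmem⟩, ?_, fun j => ?_, fun j => ?_, fun u hu hζu j => ?_⟩
  · rw [mem_closedBall_zero_iff]
    refine (σ.toContinuousLinearMap.le_opNorm ⟨t + D.g₀, hmem⟩).trans
      (mul_le_mul_of_nonneg_left ?_ (norm_nonneg _))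
    exact (norm_add_le t D.g₀).trans (by linarith)
  · have h1 := ht1 j
    have h2 := hζ j
    have h3 : 0 ≤ min ((D.G *ᵥ ζ - D.g₀) j) 1 := le_min (sub_nonneg.2 h2) zero_le_one
    rw [hη, Pi.add_apply]
    linarith
  · have := ht2 j
    rw [mulVec_sub, hη]
    simp only [Pi.sub_apply, Pi.add_apply, Pi.zero_apply] at this ⊢
    linarith
  · have h1 := ht1 j
    have h2 := hζu j
    have h3 := (norm_le_pi_norm (D.G *ᵥ u) j).trans (hball u hu)
    rw [Real.norm_eq_abs, abs_le] at h3
    simp only [mulVec_add, hη, Pi.add_apply, Pi.sub_apply] at h1 h2 ⊢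
    rcases min_le_iff.1 h1 with h | h <;> linarith

/-- Pointwise existence of local rules implies that finitely many recourse matrices and one radius
suffice for all of `Ξ`. -/
theorem exists_finite_of_pointwise
    (hx : ∀ ζ ∈ D.support, ∃ ρ > 0, ∃ Y, D.HasLocalRule x Y ζ ρ) :
    ∃ ρ > 0, ∃ 𝓒 : Set (Matrix (Fin r) (Fin d) ℝ), 𝓒.Finite ∧
      ∀ ζ ∈ D.support, ∃ Y ∈ 𝓒, D.HasLocalRule x Y ζ ρ := by
  have hfeas : ∀ ζ ∈ D.support, ∃ y, D.Feasible x ζ y := fun ζ hζ => by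
    obtain ⟨ρ, hρ, Y, y₀, hy⟩ := hx ζ hζ
    exact ⟨y₀, by simpa using hy 0 (by simpa using hρ.le) (by simpa using hζ)⟩
  obtain ⟨K, δ, hK, hδ, hrep⟩ := D.exists_compact_representatives
  have hcpt : ∃ ρ > 0, ∃ 𝓒 : Set (Matrix (Fin r) (Fin d) ℝ), 𝓒.Finite ∧
      ∀ ζ ∈ K ∩ D.support, ∃ Y ∈ 𝓒, D.HasLocalRule x Y ζ ρ := by
    refine (hK.inter_right D.isClosed_support).induction_on
      (p := fun S => ∃ ρ > 0, ∃ 𝓒 : Set (Matrix (Fin r) (Fin d) ℝ), 𝓒.Finite ∧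
        ∀ ζ ∈ S, ∃ Y ∈ 𝓒, D.HasLocalRule x Y ζ ρ) ?_ ?_ ?_ ?_
    · exact ⟨1, one_pos, ∅, Set.finite_empty, by simp⟩
    · rintro S S' hS ⟨ρ, hρ, 𝓒, hf, h⟩
      exact ⟨ρ, hρ, 𝓒, hf, fun ζ hζ => h ζ (hS hζ)⟩
    · rintro S S' ⟨ρ, hρ, 𝓒, hf, h⟩ ⟨ρ', hρ', 𝓒', hf', h'⟩
      refine ⟨min ρ ρ', lt_min hρ hρ', 𝓒 ∪ 𝓒', hf.union hf', ?_⟩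
      rintro ζ (hζ | hζ)
      · obtain ⟨Y, hY, hr⟩ := h ζ hζ
        exact ⟨Y, Or.inl hY, hr.mono (min_le_left _ _)⟩
      · obtain ⟨Y, hY, hr⟩ := h' ζ hζ
        exact ⟨Y, Or.inr hY, hr.mono (min_le_right _ _)⟩
    · rintro ζ ⟨-, hζ⟩
      obtain ⟨ρ, hρ, Y, hY⟩ := hx ζ hζ
      refine ⟨_, mem_nhdsWithin_of_mem_nhds (Metric.closedBall_mem_nhds ζ (half_pos hρ)),
        ρ / 2, half_pos hρ, {Y}, Set.finite_singleton Y, fun η hη => ⟨Y, rfl, ?_⟩⟩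
      refine hY.of_norm_sub_le ?_
      rw [mem_closedBall_iff_norm] at hη
      linarith
  obtain ⟨ρ, hρ, 𝓒, hf, h⟩ := hcpt
  refine ⟨min ρ δ, lt_min hρ hδ, 𝓒, hf, fun ζ hζ => ?_⟩
  obtain ⟨η, hηK, hη, hv, hmem⟩ := hrep ζ hζ
  obtain ⟨Y, hY, hr⟩ := h η ⟨hηK, hη⟩
  exact ⟨Y, hY, (hr.mono (min_le_left _ _)).transport hfeas hη hv
    fun u hu => hmem u (hu.trans (min_le_right _ _))⟩

/-! ### Spreading a rule from a minimal face -/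

/-- A recourse decision whose set of strictly slack constraints is as large as possible: a
constraint tight there is tight for every feasible decision. -/
theorem exists_feasible_minimal_tight {ζ : Fin d → ℝ} (h : ∃ y, D.Feasible x ζ y) :
    ∃ y, D.Feasible x ζ y ∧ ∀ j, D.slack x ζ y j = 0 →
      ∀ z, D.Feasible x ζ z → D.slack x ζ z j = 0 := by
  obtain ⟨y, hy, hmax⟩ := Set.Finite.exists_maximalFor' (fun y => {j | D.slack x ζ y j ≠ 0})
    {y | D.Feasible x ζ y} (Set.toFinite _) h
  refine ⟨y, hy, fun j hj z hz => ?_⟩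
  by_contra hne
  have hy' := feasible_iff.1 hy
  have hz' := feasible_iff.1 hz
  have hmid : ∀ i, D.slack x ζ ((1 / 2 : ℝ) • y + (1 / 2 : ℝ) • z) i =
      1 / 2 * D.slack x ζ y i + 1 / 2 * D.slack x ζ z i := fun i => by
    have := D.slack_convexComb (x := x) (add_halves 1) ζ ζ y z i
    rwa [← add_smul, add_halves, one_smul] at this
  have hle := hmax (j := (1 / 2 : ℝ) • y + (1 / 2 : ℝ) • z)
    (feasible_iff.2 fun i => by
      have := hy' i
      have := hz' i
      rw [hmid]
      positivity)
    (fun i (hi : D.slack x ζ y i ≠ 0) => by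
      have h1 := (hy' i).lt_of_ne hi.symm
      have h2 := hz' i
      rw [Set.mem_ofPred_eq, hmid]
      positivity)
  refine hle (a := j) ?_ hj
  rw [Set.mem_ofPred_eq, hmid, hj]
  simpa using hne

/-- A recourse matrix that works near `a` works near every point `ζ` of `Ξ` whose tight
inequalities are all tight at `a`. -/
theorem HasLocalRule.of_active_subset (hfeas : ∀ ζ ∈ D.support, ∃ y, D.Feasible x ζ y)
    {Y : Matrix (Fin r) (Fin d) ℝ} {a ζ : Fin d → ℝ} {ρ : ℝ} (hρ : 0 < ρ)
    (h : D.HasLocalRule x Y a ρ) (ha : a ∈ D.support) (hζ : ζ ∈ D.support)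
    (hact : D.active ζ ⊆ D.active a) : ∃ ρ' > 0, D.HasLocalRule x Y ζ ρ' := by
  obtain ⟨y₀, hy⟩ := h
  obtain ⟨y, hyf, hymin⟩ := exists_feasible_minimal_tight (hfeas ζ hζ)
  -- Scaling brings every point of `Ξ` into the range of the rule at `a`.
  have hstep : ∀ u, a + u ∈ D.support → ∃ t : ℝ, 0 < t ∧ t < 1 ∧
      ∀ s : ℝ, 0 ≤ s → s ≤ t →
        a + s • u ∈ D.support ∧ D.Feasible x (a + s • u) (y₀ + Y *ᵥ (s • u)) := by
    intro u hu
    have hpos : 0 < ‖u‖ + ρ + 1 := by positivity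
    refine ⟨ρ / (‖u‖ + ρ + 1), by positivity, (div_lt_one hpos).2 (by linarith [norm_nonneg u]),
      fun s hs0 hs => ?_⟩
    have hs1 : s ≤ 1 := hs.trans ((div_le_one hpos).2 (by linarith [norm_nonneg u]))
    have hmem : a + s • u ∈ D.support := by
      have := D.convex_support ha hu (sub_nonneg.2 hs1) hs0 (by ring)
      convert this using 1
      module
    refine ⟨hmem, hy _ ?_ hmem⟩
    rw [norm_smul, Real.norm_of_nonneg hs0]
    rw [le_div_iff₀ hpos] at hs
    nlinarith [norm_nonneg u]
  have hav : a + (ζ - a) = ζ := by abel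
  -- The segment from `a` to `ζ` can be prolonged beyond `ζ` inside `Ξ`, so a constraint
  -- tight at `ζ` for every recourse decision stays tight along the rule at `a` in the direction
  -- of `ζ`.
  obtain ⟨κ, hκ, hz⟩ := D.exists_pos_add_smul_mem_support hζ (v := ζ - a) fun j hj => by
    have h1 : D.g₀ j = _ := hj
    have h2 : D.g₀ j = _ := hact hj
    simp [mulVec_sub, ← h1, ← h2]
  obtain ⟨z, hzf⟩ := hfeas _ hz
  have htight : ∀ j, D.slack x ζ y j = 0 →
      D.slack x a y₀ j = 0 ∧ D.slackRate Y (ζ - a) j = 0 := by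
    intro j hj
    obtain ⟨t, ht0, ht1, ht⟩ := hstep (ζ - a) (by rwa [hav])
    have hzero : ∀ s : ℝ, 0 ≤ s → s ≤ t →
        D.slack x a y₀ j + s * D.slackRate Y (ζ - a) j = 0 := by
      intro s hs0 hst
      have hf := feasible_iff.1 (ht s hs0 hst).2
      have hzf' := feasible_iff.1 hzf
      -- `ζ = (1 - c) • (a + s • (ζ - a)) + c • (ζ + κ • (ζ - a))`
      have hden : 0 < 1 + κ - s := by linarith
      set c := (1 - s) / (1 + κ - s) with hc
      have hc0 : 0 ≤ c := div_nonneg (by linarith) hden.le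
      have hc1 : c < 1 := (div_lt_one hden).2 (by linarith)
      have hceq : c * (1 + κ - s) = 1 - s := div_mul_cancel₀ _ hden.ne'
      have hcomb : (1 - c) • (a + s • (ζ - a)) + c • (ζ + κ • (ζ - a)) = ζ := by
        ext i
        simp only [Pi.add_apply, Pi.smul_apply, Pi.sub_apply, smul_eq_mul]
        linear_combination (ζ i - a i) * hceq
      have hsl := fun i => D.slack_convexComb (x := x) (sub_add_cancel 1 c) (a + s • (ζ - a))
        (ζ + κ • (ζ - a)) (y₀ + Y *ᵥ (s • (ζ - a))) z i
      rw [hcomb] at hsl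
      have h0 := hymin j hj _ (feasible_iff.2 fun i => by
        rw [hsl]
        exact add_nonneg (mul_nonneg (by linarith) (hf i)) (mul_nonneg hc0 (hzf' i)))
      rw [hsl] at h0
      have h1 := mul_nonneg hc0 (hzf' j)
      have h2 := hf j
      rw [slack_add, slackRate_smul] at h0 h2
      refine le_antisymm ?_ h2
      by_contra! hlt
      have := mul_pos (sub_pos.2 hc1) hlt
      linarith
    have h0 := hzero 0 le_rfl ht0.le
    have h1 := hzero t ht0.le le_rfl
    rw [zero_mul, add_zero] at h0
    rw [h0, zero_add] at h1
    exact ⟨h0, (mul_eq_zero.1 h1).resolve_left ht0.ne'⟩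
  -- Constraints with positive slack at `(ζ, y)` survive small perturbations.
  have hnear : ∀ᶠ u : Fin d → ℝ in 𝓝 0, ∀ j, 0 < D.slack x ζ y j →
      0 < D.slack x ζ y j + D.slackRate Y u j := by
    refine eventually_all.2 fun j => ?_
    by_cases hj : 0 < D.slack x ζ y j
    · have hc : Continuous fun u : Fin d → ℝ => D.slack x ζ y j + D.slackRate Y u j := by
        unfold slackRate
        fun_prop
      have := hc.tendsto 0
      have h0 : D.slackRate Y 0 j = 0 := by simp [slackRate]
      rw [h0, add_zero] at this
      filter_upwards [this.eventually (lt_mem_nhds hj)] with u hu _ using hu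
    · exact Eventually.of_forall fun u h => absurd h hj
  obtain ⟨ρ', hρ', hball⟩ := Metric.nhds_basis_closedBall.eventually_iff.1 hnear
  refine ⟨ρ', hρ', y, fun u hu hmem => feasible_iff.2 fun j => ?_⟩
  rw [slack_add]
  rcases (feasible_iff.1 hyf j).lt_or_eq with hj | hj
  · exact (hball (by simpa using hu) j hj).le
  · obtain ⟨h0, h1⟩ := htight j hj.symm
    obtain ⟨t, ht0, -, ht⟩ := hstep (ζ - a + u) (by rwa [← add_assoc, hav])
    have := feasible_iff.1 (ht t ht0.le le_rfl).2 j
    rw [slack_add, slackRate_smul, slackRate_add, h0, h1, zero_add, zero_add] at this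
    rw [← hj, zero_add]
    exact nonneg_of_mul_nonneg_right this ht0

/-! ### Finiteness of the costs and the two kinds of balls -/

theorem Q_lt_top_iff {ζ : Fin d → ℝ} : D.Q x ζ < ⊤ ↔ ∃ y, D.Feasible x ζ y := by
  simp only [Q, iInf_lt_top, EReal.coe_lt_top, exists_prop, and_true]

theorem norm_le_of_mem_lpBall {p : ℝ≥0∞} (hp : 1 ≤ p) {c ζ : Fin d → ℝ} {ε : ℝ}
    (h : ζ ∈ lpBall p c ε) : ‖ζ - c‖ ≤ ε := by
  have : Fact (1 ≤ p) := ⟨hp⟩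
  have h' : ‖WithLp.toLp p (ζ - c)‖ ≤ ε := h
  exact (pi_norm_le_iff_of_nonneg ((norm_nonneg _).trans h')).2 fun i =>
    (PiLp.norm_apply_le (WithLp.toLp p (ζ - c)) i).trans h'

theorem exists_forall_mem_lpBall {p : ℝ≥0∞} (hp : 1 ≤ p) {ε : ℝ} (hε : 0 < ε) :
    ∃ δ > 0, ∀ c u : Fin d → ℝ, ‖u‖ ≤ δ → c + u ∈ lpBall p c ε := by
  have : Fact (1 ≤ p) := ⟨hp⟩
  have hc : Continuous fun u : Fin d → ℝ => ‖WithLp.toLp p u‖ :=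
    continuous_norm.comp (PiLp.continuous_toLp p _)
  have := hc.tendsto 0
  simp only [WithLp.toLp_zero, norm_zero] at this
  obtain ⟨δ, hδ, h⟩ := Metric.nhds_basis_closedBall.eventually_iff.1
    (this.eventually (gt_mem_nhds hε))
  refine ⟨δ, hδ, fun c u hu => ?_⟩
  have := (h (show u ∈ Metric.closedBall 0 δ by simpa using hu)).le
  simpa [lpBall] using this

theorem HasLocalRule.of_forall {Y : Matrix (Fin r) (Fin d) ℝ} {p : ℝ≥0∞} {ε δ : ℝ}
    {ζ' : Fin d → ℝ} {y₀ : Fin r → ℝ}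
    (hδ : ∀ c u : Fin d → ℝ, ‖u‖ ≤ δ → c + u ∈ lpBall p c ε)
    (h : ∀ ζ ∈ lpBall p ζ' ε ∩ D.support, D.Feasible x ζ (y₀ + Y *ᵥ ζ)) :
    D.HasLocalRule x Y ζ' δ := by
  refine ⟨y₀ + Y *ᵥ ζ', fun u hu hmem => ?_⟩
  have := h _ ⟨hδ ζ' u hu, hmem⟩
  rwa [mulVec_add, ← add_assoc] at this

theorem HasLocalRule.exists_forall {Y : Matrix (Fin r) (Fin d) ℝ} {p : ℝ≥0∞} (hp : 1 ≤ p) {ε : ℝ}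
    {ζ' : Fin d → ℝ} (h : D.HasLocalRule x Y ζ' ε) :
    ∃ y₀ : Fin r → ℝ, ∀ ζ ∈ lpBall p ζ' ε ∩ D.support, D.Feasible x ζ (y₀ + Y *ᵥ ζ) := by
  obtain ⟨y₀, hy⟩ := h
  refine ⟨y₀ - Y *ᵥ ζ', fun ζ hζ => ?_⟩
  have heq : ζ' + (ζ - ζ') = ζ := by abel
  have := hy (ζ - ζ') (norm_le_of_mem_lpBall hp hζ.1) (by rw [heq]; exact hζ.2)
  rw [heq, mulVec_sub] at this
  convert this using 1
  abel

/-- The worst-case cost of a linear rule over a ball is finite, so finiteness of `Q^𝓒_ε` only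
expresses the existence of a feasible rule. -/
theorem QC_lt_top_iff {p : ℝ≥0∞} (hp : 1 ≤ p) {𝓒 : Set (Matrix (Fin r) (Fin d) ℝ)} {ε : ℝ}
    {ζ' : Fin d → ℝ} : D.QC p 𝓒 ε x ζ' < ⊤ ↔ ∃ (y₀ : Fin r → ℝ), ∃ Y ∈ 𝓒,
      ∀ ζ ∈ lpBall p ζ' ε ∩ D.support, D.Feasible x ζ (y₀ + Y *ᵥ ζ) := by
  simp only [QC, iInf_lt_top]
  constructor
  · rintro ⟨y₀, Y, hY, h, -⟩
    exact ⟨y₀, Y, hY, h⟩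
  · rintro ⟨y₀, Y, hY, h⟩
    refine ⟨y₀, Y, hY, h, ?_⟩
    have hc : Continuous fun ζ : Fin d → ℝ => D.q ⬝ᵥ (y₀ + Y *ᵥ ζ) := by fun_prop
    obtain ⟨M, hM⟩ := (isCompact_closedBall ζ' ε).bddAbove_image hc.continuousOn
    refine lt_of_le_of_lt (iSup₂_le fun ζ hζ => ?_) (EReal.coe_lt_top M)
    refine EReal.coe_le_coe_iff.2 (hM ⟨ζ, ?_, rfl⟩)
    rw [mem_closedBall_iff_norm]
    exact norm_le_of_mem_lpBall hp hζ.1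

theorem HasLocalRule.QC_lt_top {Y : Matrix (Fin r) (Fin d) ℝ} {p : ℝ≥0∞} (hp : 1 ≤ p) {ε : ℝ}
    {ζ' : Fin d → ℝ} {𝓒 : Set (Matrix (Fin r) (Fin d) ℝ)} (h : D.HasLocalRule x Y ζ' ε)
    (hY : Y ∈ 𝓒) : D.QC p 𝓒 ε x ζ' < ⊤ := by
  obtain ⟨y₀, hy⟩ := h.exists_forall hp
  exact (QC_lt_top_iff hp).2 ⟨y₀, Y, hY, hy⟩

theorem mem_lpBall_self {p : ℝ≥0∞} (hp : 1 ≤ p) (c : Fin d → ℝ) {ε : ℝ} (hε : 0 < ε) :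
    c ∈ lpBall p c ε := by
  obtain ⟨δ, hδ, h⟩ := exists_forall_mem_lpBall (d := d) hp hε
  simpa using h c 0 (by simpa using hδ.le)

/-! ### The three implications -/

variable {p : ℝ≥0∞}

theorem LocallyLinearFeasible.minimalFaceFeasible (hp : 1 ≤ p) (h : D.LocallyLinearFeasible p) :
    D.MinimalFaceFeasible p := by
  obtain ⟨x, ε, hε, h⟩ := h
  obtain ⟨δ, hδ, hball⟩ := exists_forall_mem_lpBall (d := d) hp hε
  have hfeas : ∀ ζ ∈ D.support, ∃ y, D.Feasible x ζ y := fun ζ hζ => by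
    obtain ⟨y, -, hy⟩ := h ζ hζ
    exact ⟨y ζ, hy ζ ⟨mem_lpBall_self hp ζ hε, hζ⟩⟩
  refine ⟨x, δ, hδ, fun ζ hζ => Q_lt_top_iff.2 (hfeas ζ hζ), fun F hF => ?_⟩
  obtain ⟨a, haF⟩ := hF.1.1
  have ha := hF.1.2.subset haF
  obtain ⟨y, ⟨y₀, Y, hyY⟩, hy⟩ := h a ha
  have hr : D.HasLocalRule x Y a δ :=
    .of_forall (y₀ := y₀) hball fun ζ hζ => by simpa only [hyY] using hy ζ hζ
  refine ⟨Y, fun ζ hζ => ?_⟩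
  -- All of `F` is one lineality translate of `a`, and `Ξ` looks the same at each of its points.
  have heq := D.mulVec_eq_of_isMinimalFace hF hζ haF
  refine (hr.transport hfeas ha (by simp [mulVec_sub, heq]) fun u _ hu => ?_).QC_lt_top hp
    (Set.mem_singleton Y)
  simpa [support, mulVec_add, heq] using hu

theorem MinimalFaceFeasible.finitelyManyFeasible (hp : 1 ≤ p) (h : D.MinimalFaceFeasible p) :
    D.FinitelyManyFeasible p := by
  obtain ⟨x, ε, hε, hQ, h⟩ := h
  obtain ⟨δ, hδ, hball⟩ := exists_forall_mem_lpBall (d := d) hp hε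
  obtain ⟨ρ, hρ, 𝓒, hfin, h𝓒⟩ := exists_finite_of_pointwise (D := D) (x := x) fun ζ hζ => by
    obtain ⟨F, a, hF, haF, ha, hact⟩ := D.exists_isMinimalFace hζ
    obtain ⟨Y, hY⟩ := h F hF
    obtain ⟨y₀, _, rfl, hy⟩ := (QC_lt_top_iff hp).1 (hY a haF)
    obtain ⟨ρ, hρ, hr⟩ := HasLocalRule.of_active_subset (fun ζ hζ => Q_lt_top_iff.1 (hQ ζ hζ)) hδ
      (.of_forall hball hy) ha hζ hact
    exact ⟨ρ, hρ, _, hr⟩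
  refine ⟨x, ρ, hρ, 𝓒, hfin, fun ζ hζ => ?_⟩
  obtain ⟨Y, hY, hr⟩ := h𝓒 ζ hζ
  exact hr.QC_lt_top hp hY

theorem FinitelyManyFeasible.locallyLinearFeasible (hp : 1 ≤ p) (h : D.FinitelyManyFeasible p) :
    D.LocallyLinearFeasible p := by
  obtain ⟨x, ε, hε, 𝓒, -, h⟩ := h
  refine ⟨x, ε, hε, fun ζ hζ => ?_⟩
  obtain ⟨y₀, Y, -, hy⟩ := (QC_lt_top_iff hp).1 (h ζ hζ)
  exact ⟨fun ζ => y₀ + Y *ᵥ ζ, ⟨y₀, Y, fun _ => rfl⟩, hy⟩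

end TwoStageData

theorem mainTheorem2 {n r d m k : ℕ} (D : TwoStageData n r d m k) (p : ℝ≥0∞) (hp : 1 ≤ p) :
    List.TFAE [D.LocallyLinearFeasible p, D.MinimalFaceFeasible p, D.FinitelyManyFeasible p] := by
  tfae_have 1 → 2 := fun h => h.minimalFaceFeasible hp
  tfae_have 2 → 3 := fun h => h.finitelyManyFeasible hp
  tfae_have 3 → 1 := fun h => h.locallyLinearFeasible hp
  tfae_finish
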